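/- Let $d\ge 1$, let $R$ be a $d\times d$ integer matrix all of whose complex eigenvalues have modulus $>1$, and let $B,L\subset\mathbb{Z}^d$ be finite sets with $0\in B$, $0\in L$, $\#B=\#L=N$, such that the matrix $\frac1{\sqrt N}\left(e^{2\pi i R^{-1}b\cdot l}\right)_{b\in B,\,l\in L}$ is unitary. Put $S=R^T$, $\sigma_l(x)=S^{-1}(x+l)$ for $l\in L$, and $$W_B(x)=\Big|\frac1N\sum_{b\in B}e^{2\pi i b\cdot x}\Big|^2\qquad(x\in\mathbb{R}^d).$$ Let $\mu$ be the unique probability measure on $\mathbb{R}^d$ with $\int f\,d\mu=\frac1N\sum_{b\in B}\int f(R^{-1}(x+b))\,d\mu(x)$ for all continuous $f$, and let $\hat\mu(x)=\int e^{2\pi i t\cdot x}\,d\mu(t)$. For $x\in\mathbb{R}^d$ let $P_x$ be the unique probability measure on $\Omega=L^{\mathbb{N}}$ with $$P_x(\{\omega:\omega_1=l_1,\dots,\omega_n=l_n\})=\prod_{k=1}^nW_B(\sigma_{l_k}\cdots\sigma_{l_1}x)\qquad(n\ge 1,\ l_1,\dots,l_n\in L).$$ A closed set $F\subset\mathbb{R}^d$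 is called invariant if for every $x\in F$ it contains the closure of the union of all sets $\{\sigma_{\omega_n}\cdots\sigma_{\omega_1}x: n\ge1\}$, where $\omega\in\Omega$ satisfies $W_B(\sigma_{\omega_n}\cdots\sigma_{\omega_1}x)\ne0$ for all $n\ge1$. For such $F$ let $N(F)$ be the set of $\omega\in\Omega$ with $\lim_{n\to\infty} d(\sigma_{\omega_n}\cdots\sigma_{\omega_1}x,F)=0$ (this does not depend on $x\in\mathbb{R}^d$). A closed invariant set $F$ is called spectral, with spectrum $\Lambda\subset\mathbb{R}^d$, if $$P_x(N(F))=\sum_{\lambda\in\Lambda}|\hat\mu(x+\lambda)|^2\qquad\text{for all }x\in\mathbb{R}^d.$$ A $W_B$-cycle is a set $\mathcal C=\{x_0,\sigma_{l_1}x_0,\dots,\sigma_{l_{m-1}}\cdots\sigma_{l_1}x_0\}$ of $m\ge1$ distinct points, with $l_1,\dots,l_m\in L$ and $\sigma_{l_m}\cdots\sigma_{l_1}x_0=x_0$, such that $W_B(x)=1$ for all $x\in\mathcal C$. **Proposition.** Let $\mathcal C$ be a $W_B$-cycle. Then $\mathcal C$ is a spectral invariant set. Moreover, there is a smallest set $\Lambda\subset\mathbb{R}^d$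 (with respect to inclusion) such that $-\mathcal C\subset\Lambda$ and $S\Lambda+L\subset\Lambda$, and this $\Lambda$ is a spectrum for $\mathcal C$. -/

import Mathlib

open MeasureTheory Filter Topology
open scoped ENNReal Matrix

noncomputable section

namespace FourierIFS

variable {d : ℕ}

/-- A vector of `ℤ^d`, viewed in `ℝ^d`. -/
def vec (v : Fin d → ℤ) : Fin d → ℝ := fun i => (v i : ℝ)

/-- An integer matrix, viewed as a real matrix. -/
def realMat (R : Matrix (Fin d) (Fin d) ℤ) : Matrix (Fin d) (Fin d) ℝ :=
  R.map (fun n : ℤ => (n : ℝ))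

/-- The number `e^{2 π i t}`. -/
def expi (t : ℝ) : ℂ := Complex.exp (2 * Real.pi * Complex.I * t)

/-- The matrix `N^{-1/2} (e^{2 π i R⁻¹ b · l})`, with `b ∈ B`, `l ∈ L` and `N = #B`. -/
def hadamardMatrix (R : Matrix (Fin d) (Fin d) ℤ) (B L : Finset (Fin d → ℤ)) :
    Matrix B L ℂ :=
  Matrix.of fun b l =>
    ((1 / Real.sqrt (B.card : ℝ) : ℝ) : ℂ) * expi (((realMat R)⁻¹ *ᵥ vec b.1) ⬝ᵥ vec l.1)

/-- A Hadamard triple `(R, B, L)` in dimension `d`: `R` is an expanding integer matrix (all its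
complex eigenvalues have modulus greater than one), `B` and `L` are finite subsets of `ℤ^d` of the
same cardinality that contain `0`, and the associated square matrix is unitary. -/
structure HadamardTriple (d : ℕ) where
  R : Matrix (Fin d) (Fin d) ℤ
  B : Finset (Fin d → ℤ)
  L : Finset (Fin d → ℤ)
  expanding : ∀ z ∈ spectrum ℂ (R.map (fun n : ℤ => (n : ℂ))), 1 < ‖z‖
  zero_mem_B : (0 : Fin d → ℤ) ∈ B
  zero_mem_L : (0 : Fin d → ℤ) ∈ L
  card_eq : L.card = B.card
  unitary : hadamardMatrix R B L * (hadamardMatrix R B L)ᴴ = 1 ∧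
    (hadamardMatrix R B L)ᴴ * hadamardMatrix R B L = 1

namespace HadamardTriple

variable (T : HadamardTriple d)

/-- `N = #B`. -/
def N : ℕ := T.B.card

/-- The maps `τ_b(x) = R⁻¹ (x + b)`. -/
def tau (b : T.B) (x : Fin d → ℝ) : Fin d → ℝ := (realMat T.R)⁻¹ *ᵥ (x + vec b.1)

/-- The transpose `S = Rᵀ`. -/
def S : Matrix (Fin d) (Fin d) ℝ := (realMat T.R)ᵀ

/-- The maps `σ_l(x) = S⁻¹ (x + l)` of the dual system. -/
def sigma (l : T.L) (x : Fin d → ℝ) : Fin d → ℝ := T.S⁻¹ *ᵥ (x + vec l.1)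

/-- `W_B(x) = |N⁻¹ ∑_{b ∈ B} e^{2 π i b · x}|²`. -/
def W (x : Fin d → ℝ) : ℝ :=
  ‖(1 / (T.N : ℂ)) * ∑ b : T.B, expi (vec b.1 ⬝ᵥ x)‖ ^ 2

/-- The space of infinite words over the alphabet `L` (letters are numbered from `0`). -/
abbrev Words : Type := ℕ → T.L

/-- `walk ω n x = σ_{ω (n-1)} ⋯ σ_{ω 0} x`, the image of `x` under the first `n` letters. -/
def walk (ω : T.Words) : ℕ → (Fin d → ℝ) → (Fin d → ℝ)
  | 0, x => x
  | n + 1, x => T.sigma (ω n) (walk ω n x)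

/-- The union of all trajectories of `x`. -/
def trajectories (x : Fin d → ℝ) : Set (Fin d → ℝ) :=
  {y | ∃ ω : T.Words, (∀ n ≥ 1, T.W (T.walk ω n x) ≠ 0) ∧ ∃ n ≥ 1, y = T.walk ω n x}

/-- The orbit of `x`: the closure of the union of its trajectories. -/
def orbit (x : Fin d → ℝ) : Set (Fin d → ℝ) := closure (T.trajectories x)

/-- A closed set is invariant if it contains the orbit of each of its points. -/
def IsClosedInvariant (F : Set (Fin d → ℝ)) : Prop :=
  IsClosed F ∧ ∀ x ∈ F, T.orbit x ⊆ F

/-- `C = {x₀, σ_{l₁} x₀, …, σ_{l_{m-1}} ⋯ σ_{l₁} x₀}` with these `m ≥ 1` points distinct and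
`σ_{l_m} ⋯ σ_{l₁} x₀ = x₀`. Only the first `m` letters of the word `l` matter. -/
def IsCycle (C : Set (Fin d → ℝ)) : Prop :=
  ∃ (m : ℕ) (l : T.Words) (x₀ : Fin d → ℝ), 1 ≤ m ∧
    Set.InjOn (fun k => T.walk l k x₀) (Set.Iio m) ∧
    T.walk l m x₀ = x₀ ∧
    C = (fun k => T.walk l k x₀) '' Set.Iio m

/-- A `W_B`-cycle. -/
def IsWCycle (C : Set (Fin d → ℝ)) : Prop :=
  T.IsCycle C ∧ ∀ x ∈ C, T.W x = 1

/-- The defining property of the invariant measure of the system `(τ_b)`. -/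
def IsInvariantMeasure (μ : Measure (Fin d → ℝ)) : Prop :=
  IsProbabilityMeasure μ ∧ ∀ f : (Fin d → ℝ) → ℂ, Continuous f →
    ∫ t, f t ∂μ = (1 / (T.N : ℂ)) * ∑ b : T.B, ∫ t, f (T.tau b t) ∂μ

/-- The defining property of the path measure started at `x`: the cylinder of the words that begin
with `l₁ … l_n` has mass `∏_{k=1}^n W_B(σ_{l_k} ⋯ σ_{l₁} x)`. -/
def IsPathMeasure (x : Fin d → ℝ) (P : Measure T.Words) : Prop :=
  IsProbabilityMeasure P ∧ ∀ (n : ℕ) (l : T.Words),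
    P {ω | ∀ k < n, ω k = l k} =
      ENNReal.ofReal (∏ k ∈ Finset.range n, T.W (T.walk l (k + 1) x))

/-! ### Existence and uniqueness of the invariant measure and of the path measures -/

section Norm

attribute [local instance] Matrix.linftyOpNormedRing Matrix.linftyOpNormedAlgebra

lemma det_ne_zero : (realMat T.R).det ≠ 0 := by
  intro h
  have h0 : (0 : ℂ) ∈ spectrum ℂ (T.R.map (fun n : ℤ => (n : ℂ))) := by
    rw [spectrum.zero_mem_iff, Matrix.isUnit_iff_isUnit_det]
    have h1 : (realMat T.R).det = ((T.R.det : ℤ) : ℝ) := by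
      rw [realMat]; exact (Int.castRingHom ℝ).map_det T.R |>.symm
    have h2 : (T.R.map (fun n : ℤ => (n : ℂ))).det = ((T.R.det : ℤ) : ℂ) :=
      (Int.castRingHom ℂ).map_det T.R |>.symm
    have h3 : T.R.det = 0 := by
      rw [h1] at h; exact_mod_cast h
    rw [h2, h3]; simp
  have := T.expanding 0 h0
  simp at this
  linarith

lemma summable_entry (i j : Fin d) : Summable fun k : ℕ => |((realMat T.R)⁻¹ ^ k) i j| := by
  have : Nonempty (Fin d) := ⟨i⟩
  set A : Matrix (Fin d) (Fin d) ℂ := ((realMat T.R)⁻¹).map (fun r : ℝ => (r : ℂ)) with hA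
  have hAR : A * T.R.map (fun n : ℤ => (n : ℂ)) = 1 := by
    have h1 : (realMat T.R)⁻¹ * realMat T.R = 1 :=
      Matrix.nonsing_inv_mul _ (isUnit_iff_ne_zero.mpr T.det_ne_zero)
    have h2 : T.R.map (fun n : ℤ => (n : ℂ)) = (realMat T.R).map (Complex.ofRealHom) := by
      ext a b; simp [realMat]
    have h3 : A = ((realMat T.R)⁻¹).map (Complex.ofRealHom) := rfl
    rw [h2, h3, ← Matrix.map_mul, h1]
    simp
  have hRA : T.R.map (fun n : ℤ => (n : ℂ)) * A = 1 := mul_eq_one_comm.mp hAR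
  let u : (Matrix (Fin d) (Fin d) ℂ)ˣ := ⟨T.R.map (fun n : ℤ => (n : ℂ)), A, hRA, hAR⟩
  have hspec : ∀ z ∈ spectrum ℂ A, ‖z‖₊ < 1 := by
    intro z hz
    have hz0 : z ≠ 0 := by
      rintro rfl
      exact spectrum.zero_notMem ℂ (⟨u⁻¹, rfl⟩ : IsUnit A) hz
    have h1 : ((Units.mk0 z hz0)⁻¹ : ℂˣ).1 ∈ spectrum ℂ ((u⁻¹)⁻¹ : (Matrix (Fin d) (Fin d) ℂ)ˣ).1 :=
      spectrum.inv_mem_iff.mp hz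
    have h2 := T.expanding z⁻¹ (by simpa [u] using h1)
    rw [norm_inv] at h2
    have h3 : ‖z‖ < 1 := by
      by_contra hcon
      push Not at hcon
      exact absurd (inv_le_one_of_one_le₀ hcon) (not_le.mpr h2)
    exact_mod_cast h3
  have hr : spectralRadius ℂ A < (1 : NNReal) := spectrum.spectralRadius_lt_of_forall_lt A hspec
  obtain ⟨r, hr1, hr2⟩ := exists_between hr
  have hr2' : r < 1 := by simpa using hr2
  have hev : ∀ᶠ n : ℕ in atTop, (‖A ^ n‖₊ : ℝ≥0∞) ^ (1 / n : ℝ) < r :=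
    (spectrum.pow_nnnorm_pow_one_div_tendsto_nhds_spectralRadius A).eventually (gt_mem_nhds hr1)
  have hrt : r ≠ ∞ := ne_top_of_lt hr2
  have hle : ∀ᶠ n : ℕ in atTop, ‖A ^ n‖ ≤ r.toReal ^ n := by
    filter_upwards [hev, eventually_ge_atTop 1] with n hn hn1
    have h1 : (‖A ^ n‖₊ : ℝ≥0∞) ≤ r ^ n := by
      have hn0 : (n : ℝ) ≠ 0 := by positivity
      calc (‖A ^ n‖₊ : ℝ≥0∞) = ((‖A ^ n‖₊ : ℝ≥0∞) ^ (1 / n : ℝ)) ^ (n : ℝ) := by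
            rw [← ENNReal.rpow_mul, one_div, inv_mul_cancel₀ hn0, ENNReal.rpow_one]
        _ ≤ r ^ (n : ℝ) := ENNReal.rpow_le_rpow hn.le (by positivity)
        _ = r ^ n := ENNReal.rpow_natCast r n
    have h2 := ENNReal.toReal_mono (ENNReal.pow_ne_top hrt) h1
    simpa using h2
  have hr3 : r.toReal < 1 := by
    rw [← ENNReal.toReal_one]; exact (ENNReal.toReal_lt_toReal hrt ENNReal.one_ne_top).mpr hr2'
  refine Summable.of_norm_bounded_eventually_nat
    (summable_geometric_of_lt_one ENNReal.toReal_nonneg hr3) ?_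
  filter_upwards [hle] with n hn
  refine le_trans ?_ hn
  have h1 : A ^ n = ((realMat T.R)⁻¹ ^ n).map (Complex.ofRealHom) := by
    rw [Matrix.map_pow]; rfl
  have h2 : ‖(A ^ n) i j‖ ≤ ‖A ^ n‖ := by
    rw [Matrix.linfty_opNorm_def]
    have h3 : ‖(A ^ n) i j‖₊ ≤ ∑ j, ‖(A ^ n) i j‖₊ :=
      Finset.single_le_sum (f := fun j => ‖(A ^ n) i j‖₊) (fun _ _ => zero_le) (Finset.mem_univ j)
    have h4 : ∑ j, ‖(A ^ n) i j‖₊ ≤ Finset.univ.sup fun i => ∑ j, ‖(A ^ n) i j‖₊ :=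
      Finset.le_sup (f := fun i => ∑ j, ‖(A ^ n) i j‖₊) (Finset.mem_univ i)
    exact_mod_cast h3.trans h4
  rw [h1] at h2
  rw [h1]
  simpa using h2

end Norm

lemma summable_pow_mulVec (v : Fin d → ℝ) :
    Summable fun k : ℕ => ‖((realMat T.R)⁻¹ ^ k) *ᵥ v‖ := by
  have h : Summable fun k : ℕ => ∑ i, ∑ j, |((realMat T.R)⁻¹ ^ k) i j| * |v j| :=
    summable_sum fun i _ => summable_sum fun j _ => (T.summable_entry i j).mul_right _
  refine Summable.of_nonneg_of_le (fun _ => norm_nonneg _) (fun k => ?_) h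
  refine (pi_norm_le_iff_of_nonneg (by positivity)).mpr fun i => ?_
  calc ‖(((realMat T.R)⁻¹ ^ k) *ᵥ v) i‖ ≤ ∑ j, |((realMat T.R)⁻¹ ^ k) i j| * |v j| := by
        rw [Matrix.mulVec, dotProduct, Real.norm_eq_abs]
        refine (Finset.abs_sum_le_sum_abs _ _).trans (le_of_eq ?_)
        simp [abs_mul]
    _ ≤ _ := Finset.single_le_sum
        (f := fun i => ∑ j, |((realMat T.R)⁻¹ ^ k) i j| * |v j|)
        (fun i _ => by positivity) (Finset.mem_univ i)

lemma tendsto_inv_S_pow (v : Fin d → ℝ) :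
    Tendsto (fun k : ℕ => (T.S⁻¹ ^ k) *ᵥ v) atTop (𝓝 0) := by
  have hS : ∀ k : ℕ, T.S⁻¹ ^ k = ((realMat T.R)⁻¹ ^ k)ᵀ := by
    intro k; rw [S, ← Matrix.transpose_nonsing_inv, Matrix.transpose_pow]
  refine tendsto_pi_nhds.mpr fun i => ?_
  simp only [hS, Matrix.mulVec, dotProduct, Matrix.transpose_apply, Pi.zero_apply]
  have : Tendsto (fun k : ℕ => ∑ j, ((realMat T.R)⁻¹ ^ k) j i * v j) atTop
      (𝓝 (∑ j : Fin d, 0 * v j)) := by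
    refine tendsto_finsetSum _ fun j _ => Tendsto.mul_const _ ?_
    exact (tendsto_zero_iff_abs_tendsto_zero _).mpr (T.summable_entry j i).tendsto_atTop_zero
  simpa using this

end HadamardTriple

lemma expi_add (s t : ℝ) : expi (s + t) = expi s * expi t := by
  simp only [expi, ← Complex.exp_add]; congr 1; push_cast; ring

lemma norm_expi (t : ℝ) : ‖expi t‖ = 1 := by
  have : expi t = Complex.exp ((2 * Real.pi * t : ℝ) * Complex.I) := by
    simp only [expi]; congr 1; push_cast; ring
  rw [this, Complex.norm_exp_ofReal_mul_I]

@[fun_prop]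
lemma continuous_expi : Continuous expi := by unfold expi; fun_prop

namespace HadamardTriple

variable (T : HadamardTriple d)

lemma N_pos : 0 < T.N := Finset.card_pos.mpr ⟨0, T.zero_mem_B⟩

instance : Nonempty T.B := ⟨⟨0, T.zero_mem_B⟩⟩
instance : Nonempty T.L := ⟨⟨0, T.zero_mem_L⟩⟩

lemma W_nonneg (x : Fin d → ℝ) : 0 ≤ T.W x := by unfold W; positivity

lemma dot_inv_S (b x : Fin d → ℝ) : b ⬝ᵥ (T.S⁻¹ *ᵥ x) = ((realMat T.R)⁻¹ *ᵥ b) ⬝ᵥ x := by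
  rw [Matrix.dotProduct_mulVec, S, ← Matrix.transpose_nonsing_inv, Matrix.vecMul_transpose]

lemma sum_W (x : Fin d → ℝ) : ∑ l : T.L, T.W (T.sigma l x) = 1 := by
  set H := hadamardMatrix T.R T.B T.L with hH
  have hN : (0 : ℝ) < T.N := by exact_mod_cast T.N_pos
  let v : T.B → ℂ := fun b => expi (((realMat T.R)⁻¹ *ᵥ vec b.1) ⬝ᵥ x)
  have h1 : ∀ l : T.L, T.W (T.sigma l x) = (1 / (T.N : ℝ)) * ‖(v ᵥ* H) l‖ ^ 2 := by
    intro l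
    have h2 : (v ᵥ* H) l = ((1 / Real.sqrt (T.N : ℝ) : ℝ) : ℂ) *
        ∑ b : T.B, expi (vec b.1 ⬝ᵥ T.sigma l x) := by
      rw [Matrix.vecMul, dotProduct, Finset.mul_sum]
      refine Finset.sum_congr rfl fun b _ => ?_
      rw [sigma, dot_inv_S, dotProduct_add, expi_add, hH]
      simp only [v, hadamardMatrix, Matrix.of_apply, N]
      ring
    rw [h2, W, norm_mul, norm_mul, mul_pow, mul_pow, ← mul_assoc]
    congr 1
    rw [Complex.norm_real, Real.norm_of_nonneg (by positivity), div_pow, Real.sq_sqrt hN.le,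
      norm_div, norm_one, Complex.norm_natCast]
    field_simp
  have h3 : ∑ l : T.L, ((‖(v ᵥ* H) l‖ ^ 2 : ℝ) : ℂ) = T.N := by
    have h4 : ∑ l : T.L, ((‖(v ᵥ* H) l‖ ^ 2 : ℝ) : ℂ) = (v ᵥ* H) ⬝ᵥ star (v ᵥ* H) := by
      rw [dotProduct]
      refine Finset.sum_congr rfl fun l _ => ?_
      rw [Pi.star_apply, Complex.star_def, Complex.mul_conj, Complex.normSq_eq_norm_sq]
    rw [h4, Matrix.star_vecMul, Matrix.dotProduct_mulVec, Matrix.vecMul_vecMul, T.unitary.1,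
      Matrix.vecMul_one, dotProduct]
    have h5 : ∀ b : T.B, v b * star v b = 1 := by
      intro b
      rw [Pi.star_apply, Complex.star_def, Complex.mul_conj, Complex.normSq_eq_norm_sq]
      simp [v, norm_expi]
    rw [Finset.sum_congr rfl fun b _ => h5 b]
    simp [N]
  have h6 : ∑ l : T.L, ‖(v ᵥ* H) l‖ ^ 2 = (T.N : ℝ) := by exact_mod_cast h3
  simp only [h1]
  rw [← Finset.mul_sum, h6]
  field_simp


/-- The law of the next letter when the present position is `y`. -/
def stepLaw (y : Fin d → ℝ) : Measure T.L :=
  ∑ l : T.L, ENNReal.ofReal (T.W (T.sigma l y)) • Measure.dirac l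

lemma stepLaw_singleton (y : Fin d → ℝ) (l : T.L) :
    T.stepLaw y {l} = ENNReal.ofReal (T.W (T.sigma l y)) := by
  classical
  simp only [stepLaw, Measure.finsetSum_apply, Measure.smul_apply, smul_eq_mul,
    Measure.dirac_apply' _ (measurableSet_singleton l), Set.indicator_apply,
    Set.mem_singleton_iff, Pi.one_apply, mul_ite, mul_one, mul_zero]
  simp

instance (y : Fin d → ℝ) : IsProbabilityMeasure (T.stepLaw y) := by
  constructor
  simp only [stepLaw, Measure.finsetSum_apply, Measure.smul_apply, smul_eq_mul, measure_univ,
    mul_one]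
  rw [← ENNReal.ofReal_sum_of_nonneg fun l _ => T.W_nonneg _, T.sum_W, ENNReal.ofReal_one]

lemma walk_congr {ω η : T.Words} {n : ℕ} (h : ∀ k < n, ω k = η k) (x : Fin d → ℝ) :
    T.walk ω n x = T.walk η n x := by
  induction n with
  | zero => rfl
  | succ n ih =>
    rw [walk, walk, h n (Nat.lt_succ_self n), ih fun k hk => h k (hk.trans (Nat.lt_succ_self n))]

lemma measurableSet_cylinder (n : ℕ) (l : T.Words) :
    MeasurableSet {ω : T.Words | ∀ k < n, ω k = l k} := by
  have : {ω : T.Words | ∀ k < n, ω k = l k} = ⋂ k ∈ Set.Iio n, {ω | ω k = l k} := by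
    ext ω; simp
  rw [this]
  exact MeasurableSet.biInter (Set.to_countable _) fun k _ =>
    measurableSet_eq_fun (measurable_pi_apply k) measurable_const

lemma exists_isPathMeasure (x : Fin d → ℝ) : ∃ P, T.IsPathMeasure x P := by
  let w : (n : ℕ) → (Finset.Iic n → T.L) → T.Words := fun n h k =>
    if hk : k + 1 ≤ n then h ⟨k + 1, Finset.mem_Iic.mpr hk⟩ else Classical.arbitrary _
  let κ : (n : ℕ) → ProbabilityTheory.Kernel (Finset.Iic n → T.L) T.L := fun n =>
    { toFun := fun h => T.stepLaw (T.walk (w n h) n x)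
      measurable' := measurable_of_countable _ }
  have hκ : ∀ n, ProbabilityTheory.IsMarkovKernel (κ n) := fun n =>
    ⟨fun h => inferInstanceAs (IsProbabilityMeasure (T.stepLaw _))⟩
  let l₀ : T.L := Classical.arbitrary _
  let Q := ProbabilityTheory.Kernel.traj (X := fun _ => T.L) κ 0 (fun _ => l₀)
  let ext : T.Words → (ℕ → T.L) := fun l n => Nat.casesOn n l₀ l
  have hpart : ∀ (l : T.Words) (n : ℕ),
      ProbabilityTheory.Kernel.partialTraj (X := fun _ => T.L) κ 0 n (fun _ => l₀)
        {Preorder.frestrictLe n (ext l)} =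
      ENNReal.ofReal (∏ k ∈ Finset.range n, T.W (T.walk l (k + 1) x)) := by
    intro l n
    induction n with
    | zero =>
      rw [ProbabilityTheory.Kernel.partialTraj_self, ProbabilityTheory.Kernel.id_apply,
        Measure.dirac_apply' _ (measurableSet_singleton _)]
      have : (fun _ => l₀ : Finset.Iic 0 → T.L) = Preorder.frestrictLe (π := fun _ => T.L) 0 (ext l) := by
        ext1 ⟨k, hk⟩
        have hk0 : k = 0 := by simpa using hk
        subst hk0
        rfl
      simp [this]
    | succ n ih =>
      have hpre : (IicProdIoc (X := fun _ => T.L) n (n + 1)) ⁻¹'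
          {Preorder.frestrictLe (π := fun _ => T.L) (n + 1) (ext l)} =
          {Preorder.frestrictLe (π := fun _ => T.L) n (ext l)} ×ˢ
            {MeasurableEquiv.piSingleton (X := fun _ => T.L) n (l n)} := by
        ext ⟨p, q⟩
        simp only [Set.mem_preimage, Set.mem_singleton_iff, Set.mem_prod]
        constructor
        · intro h
          have h' : ∀ k (hk : k ∈ Finset.Iic (n + 1)), IicProdIoc (X := fun _ => T.L) n (n + 1)
              (p, q) ⟨k, hk⟩ = ext l k := fun k hk => congrFun h ⟨k, hk⟩
          constructor
          · ext1 ⟨k, hk⟩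
            have hk' := Finset.mem_Iic.mp hk
            have := h' k (Finset.mem_Iic.mpr (hk'.trans (Nat.le_succ n)))
            rw [IicProdIoc_def] at this
            simpa [hk'] using this
          · refine (MeasurableEquiv.piSingleton (X := fun _ => T.L) n).symm.injective ?_
            rw [MeasurableEquiv.symm_apply_apply]
            have := h' (n + 1) (Finset.mem_Iic.mpr le_rfl)
            rw [IicProdIoc_def] at this
            have h2 : q ⟨n + 1, Finset.mem_Ioc.mpr ⟨Nat.lt_succ_self n, le_rfl⟩⟩ = l n := by
              simpa [ext] using this
            exact h2
        · rintro ⟨rfl, rfl⟩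
          ext1 ⟨k, hk⟩
          rw [IicProdIoc_def]
          have hk' := Finset.mem_Iic.mp hk
          rcases Nat.le_succ_iff.mp hk' with h | rfl
          · simp [h]
          · have : MeasurableEquiv.piSingleton (X := fun _ => T.L) n (l n)
                ⟨n + 1, Finset.mem_Ioc.mpr ⟨Nat.lt_succ_self n, le_rfl⟩⟩ = l n :=
              (MeasurableEquiv.piSingleton (X := fun _ => T.L) n).symm_apply_apply (l n)
            simpa [ext] using this
      rw [ProbabilityTheory.Kernel.partialTraj_succ_of_le (Nat.zero_le n),
        ProbabilityTheory.Kernel.map_apply' _ (by fun_prop) _ (measurableSet_singleton _), hpre,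
        ProbabilityTheory.Kernel.comp_apply' _ _ _ (by measurability)]
      have hint : ∀ h : Finset.Iic n → T.L,
          (ProbabilityTheory.Kernel.prod ProbabilityTheory.Kernel.id
            ((κ n).map (MeasurableEquiv.piSingleton (X := fun _ => T.L) n)) h)
            ({Preorder.frestrictLe (π := fun _ => T.L) n (ext l)} ×ˢ
              {MeasurableEquiv.piSingleton (X := fun _ => T.L) n (l n)}) =
          Set.indicator {Preorder.frestrictLe (π := fun _ => T.L) n (ext l)}
            (fun _ => ENNReal.ofReal (T.W (T.walk l (n + 1) x))) h := by
        intro h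
        rw [ProbabilityTheory.Kernel.prod_apply_prod, ProbabilityTheory.Kernel.id_apply,
          Measure.dirac_apply' _ (measurableSet_singleton _)]
        by_cases hh : h = Preorder.frestrictLe (π := fun _ => T.L) n (ext l)
        · have hw : T.walk (w n h) n x = T.walk l n x := by
            refine T.walk_congr (fun k hk => ?_) x
            subst hh
            simp only [w, dif_pos (Nat.succ_le_of_lt hk)]
            rfl
          have hp : MeasurableEquiv.piSingleton (X := fun _ => T.L) n ⁻¹'
              {MeasurableEquiv.piSingleton (X := fun _ => T.L) n (l n)} = {l n} := by
            ext a; simp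
          rw [ProbabilityTheory.Kernel.map_apply' _ (MeasurableEquiv.measurable _) _
            (measurableSet_singleton _), hp]
          have hκn : κ n h {l n} = ENNReal.ofReal (T.W (T.walk l (n + 1) x)) := by
            change T.stepLaw (T.walk (w n h) n x) {l n} = _
            rw [stepLaw_singleton, hw]
            rfl
          rw [hκn]
          simp [hh]
        · simp [hh]
      simp_rw [hint]
      rw [lintegral_indicator_const (measurableSet_singleton _), ih, mul_comm,
        ← ENNReal.ofReal_mul (Finset.prod_nonneg fun _ _ => T.W_nonneg _), Finset.prod_range_succ]
  have hQ : ∀ (l : T.Words) (n : ℕ), Q {ω | ∀ k ≤ n, ω k = ext l k} =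
      ENNReal.ofReal (∏ k ∈ Finset.range n, T.W (T.walk l (k + 1) x)) := by
    intro l n
    rw [← hpart, ← ProbabilityTheory.Kernel.traj_map_frestrictLe_apply,
      Measure.map_apply (by fun_prop) (measurableSet_singleton _)]
    congr 1
    ext ω
    simp only [Set.mem_ofPred_eq, Set.mem_preimage, Set.mem_singleton_iff, funext_iff,
      Preorder.frestrictLe_apply, Subtype.forall, Finset.mem_Iic]
  have hQ0 : ∀ᵐ ω ∂Q, ω 0 = l₀ := by
    have := hQ (fun _ => l₀) 0
    simp only [Nat.le_zero, forall_eq, Finset.range_zero, Finset.prod_empty,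
      ENNReal.ofReal_one] at this
    exact (prob_compl_eq_zero_iff (measurableSet_eq_fun (by fun_prop) (by fun_prop))).mpr this
  have hm : Measurable fun (ω : ℕ → T.L) (n : ℕ) => ω (n + 1) :=
    measurable_pi_lambda _ fun n => measurable_pi_apply (n + 1)
  refine ⟨Q.map fun ω n => ω (n + 1), Measure.isProbabilityMeasure_map hm.aemeasurable, ?_⟩
  intro n l
  rw [Measure.map_apply hm (T.measurableSet_cylinder n l), ← hQ l n]
  refine measure_congr ?_
  filter_upwards [hQ0] with ω hω
  refine propext ⟨fun h k hk => ?_, fun h k hk => h (k + 1) hk⟩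
  cases k with
  | zero => exact hω
  | succ k => exact h k hk

lemma IsPathMeasure.unique {x : Fin d → ℝ} {P P' : Measure T.Words}
    (h : T.IsPathMeasure x P) (h' : T.IsPathMeasure x P') : P = P' := by
  have := h.1
  have := h'.1
  have key : ∀ n : ℕ, P.map (Preorder.frestrictLe (π := fun _ => T.L) n) = P'.map (Preorder.frestrictLe (π := fun _ => T.L) n) := by
    intro n
    refine Measure.ext_of_singleton fun s => ?_
    have hs : ∃ l : T.Words, Preorder.frestrictLe (π := fun _ => T.L) n l = s :=
      ⟨fun k => if hk : k ≤ n then s ⟨k, Finset.mem_Iic.mpr hk⟩ else Classical.arbitrary _, by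
        ext1 ⟨k, hk⟩; simp [Finset.mem_Iic.mp hk]⟩
    obtain ⟨l, rfl⟩ := hs
    have hset : (Preorder.frestrictLe (π := fun _ => T.L) n) ⁻¹' {Preorder.frestrictLe (π := fun _ => T.L) n l} =
        {ω : T.Words | ∀ k < n + 1, ω k = l k} := by
      ext ω
      simp only [Set.mem_ofPred_eq, Set.mem_preimage, Set.mem_singleton_iff, funext_iff,
        Preorder.frestrictLe_apply, Subtype.forall, Finset.mem_Iic, Nat.lt_succ_iff]
    rw [Measure.map_apply (by fun_prop) (measurableSet_singleton _),
      Measure.map_apply (by fun_prop) (measurableSet_singleton _), hset, h.2, h'.2]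
  have hproj : IsProjectiveLimit P' (fun I : Finset ℕ => P.map I.restrict) := by
    intro I
    have hI : I ⊆ Finset.Iic (I.sup id) := fun i hi => Finset.mem_Iic.mpr (Finset.le_sup (f := id) hi)
    have hc : (I.restrict : T.Words → I → T.L) = Finset.restrict₂ (π := fun _ => T.L) hI ∘
        Preorder.frestrictLe (π := fun _ => T.L) (I.sup id) := rfl
    have hm1 : Measurable (Finset.restrict₂ (π := fun _ => T.L) hI) := by fun_prop
    have hm2 : Measurable (Preorder.frestrictLe (π := fun _ => T.L) (I.sup id)) := by fun_prop
    change P'.map I.restrict = P.map I.restrict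
    rw [hc, ← Measure.map_map hm1 hm2, ← Measure.map_map hm1 hm2, key]
  have hproj0 : IsProjectiveLimit P (fun I : Finset ℕ => P.map I.restrict) := fun I => rfl
  have : ∀ I : Finset ℕ, IsFiniteMeasure (P.map I.restrict) := fun I => inferInstance
  exact hproj0.unique hproj



/-- The point `∑_{k ≥ 1} R^{-k} b_k` coded by the word `b₁ b₂ …` over `B`. -/
def coding (ω : ℕ → T.B) : Fin d → ℝ := ∑' k, ((realMat T.R)⁻¹ ^ (k + 1)) *ᵥ vec (ω k).1

lemma norm_coding_term_le (k : ℕ) (ω : ℕ → T.B) :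
    ‖((realMat T.R)⁻¹ ^ (k + 1)) *ᵥ vec (ω k).1‖ ≤
      ∑ b : T.B, ‖((realMat T.R)⁻¹ ^ (k + 1)) *ᵥ vec b.1‖ :=
  Finset.single_le_sum (f := fun b : T.B => ‖((realMat T.R)⁻¹ ^ (k + 1)) *ᵥ vec b.1‖)
    (fun _ _ => norm_nonneg _) (Finset.mem_univ (ω k))

lemma summable_bound :
    Summable fun k : ℕ => ∑ b : T.B, ‖((realMat T.R)⁻¹ ^ (k + 1)) *ᵥ vec b.1‖ :=
  summable_sum fun b _ => (summable_nat_add_iff 1).mpr (T.summable_pow_mulVec (vec b.1))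

lemma summable_coding (ω : ℕ → T.B) :
    Summable fun k : ℕ => ((realMat T.R)⁻¹ ^ (k + 1)) *ᵥ vec (ω k).1 :=
  Summable.of_norm_bounded T.summable_bound fun k => T.norm_coding_term_le k ω

lemma continuous_coding : Continuous T.coding :=
  continuous_tsum (fun k => (continuous_of_discreteTopology
      (f := fun b : T.B => ((realMat T.R)⁻¹ ^ (k + 1)) *ᵥ vec b.1)).comp (continuous_apply k))
    T.summable_bound fun k ω => T.norm_coding_term_le k ω

/-- The word `b ω₀ ω₁ …`. -/
def consWord (b : T.B) (ω : ℕ → T.B) : ℕ → T.B := fun n => Nat.casesOn n b ω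

lemma coding_consWord (b : T.B) (ω : ℕ → T.B) :
    T.coding (T.consWord b ω) = T.tau b (T.coding ω) := by
  have h := (T.summable_coding (T.consWord b ω)).tsum_eq_zero_add
  have hcont : Continuous fun v : Fin d → ℝ => (realMat T.R)⁻¹ *ᵥ v :=
    (Matrix.mulVecLin (realMat T.R)⁻¹).continuous_of_finiteDimensional
  have h2 : (realMat T.R)⁻¹ *ᵥ T.coding ω =
      ∑' k, ((realMat T.R)⁻¹ ^ (k + 1 + 1)) *ᵥ vec (ω k).1 := by
    have := ((T.summable_coding ω).hasSum.map (Matrix.mulVecLin (realMat T.R)⁻¹) hcont).tsum_eq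
    rw [coding]
    refine this.symm.trans (tsum_congr fun k => ?_)
    simp only [Function.comp_apply, Matrix.mulVecLin_apply, Matrix.mulVec_mulVec]
    rw [← pow_succ']
  rw [tau, Matrix.mulVec_add, h2, add_comm, coding, h]
  simp [consWord]

/-- The uniform law on `B`. -/
def unif : Measure T.B := (T.N : ℝ≥0∞)⁻¹ • Measure.count

lemma unif_singleton (b : T.B) : T.unif {b} = (T.N : ℝ≥0∞)⁻¹ := by
  simp [unif]

instance : IsProbabilityMeasure T.unif := by
  constructor
  have : (T.N : ℝ≥0∞) ≠ 0 := by exact_mod_cast T.N_pos.ne'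
  rw [unif, Measure.smul_apply, Measure.count_univ, smul_eq_mul]
  have h : ENat.card T.B = T.N := by simp [N]
  rw [h]
  simpa using ENNReal.inv_mul_cancel this (by simp)

lemma measurable_consWord : Measurable fun p : T.B × (ℕ → T.B) => T.consWord p.1 p.2 := by
  refine measurable_pi_lambda _ fun n => ?_
  cases n with
  | zero => exact measurable_fst
  | succ n => exact (measurable_pi_apply n).comp measurable_snd

lemma map_consWord :
    (T.unif.prod (Measure.infinitePi fun _ : ℕ => T.unif)).map
      (fun p : T.B × (ℕ → T.B) => T.consWord p.1 p.2) = Measure.infinitePi fun _ : ℕ => T.unif := by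
  classical
  refine Measure.eq_infinitePi _ fun s t ht => ?_
  rw [Measure.map_apply T.measurable_consWord (MeasurableSet.pi (Set.to_countable _) fun i _ => ht i)]
  let s' : Finset ℕ := s.preimage Nat.succ (Nat.succ_injective.injOn)
  have hs' : ∀ n, n ∈ s' ↔ n + 1 ∈ s := fun n => by simp [s']
  have hpre : (fun p : T.B × (ℕ → T.B) => T.consWord p.1 p.2) ⁻¹' (Set.pi s t) =
      (if 0 ∈ s then t 0 else Set.univ) ×ˢ (Set.pi s' fun n => t (n + 1)) := by
    ext ⟨b, ω⟩
    simp only [Set.mem_preimage, Set.mem_pi, Set.mem_prod, Finset.mem_coe]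
    constructor
    · intro h
      refine ⟨?_, fun n hn => h (n + 1) ((hs' n).mp hn)⟩
      split_ifs with h0
      · exact h 0 h0
      · trivial
    · rintro ⟨h1, h2⟩ n hn
      cases n with
      | zero => rw [if_pos hn] at h1; exact h1
      | succ n => exact h2 n ((hs' n).mpr hn)
  rw [hpre, Measure.prod_prod, Measure.infinitePi_pi _ (fun i _ => ht (i + 1))]
  have himg : ∏ i ∈ s', T.unif (t (i + 1)) = ∏ i ∈ s.erase 0, T.unif (t i) := by
    refine Finset.prod_bij (fun i _ => i + 1) ?_ ?_ ?_ ?_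
    · intro a ha; simpa using (hs' a).mp ha
    · intro a _ b _ h; simpa using h
    · intro b hb
      obtain ⟨hb0, hbs⟩ := Finset.mem_erase.mp hb
      obtain ⟨c, rfl⟩ := Nat.exists_eq_succ_of_ne_zero hb0
      exact ⟨c, (hs' c).mpr hbs, rfl⟩
    · intros; rfl
  rw [himg]
  split_ifs with h0
  · exact Finset.mul_prod_erase s (fun i => T.unif (t i)) h0
  · rw [measure_univ, one_mul, Finset.erase_eq_of_notMem h0]

lemma exists_isInvariantMeasure : ∃ μ, T.IsInvariantMeasure μ := by
  let ν : Measure (ℕ → T.B) := Measure.infinitePi fun _ : ℕ => T.unif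
  have hmeas : Measurable T.coding := T.continuous_coding.measurable
  have hint : ∀ g : (ℕ → T.B) → ℂ, Continuous g → Integrable g ν := fun g hg =>
    integrableOn_univ.mp (hg.continuousOn.integrableOn_compact isCompact_univ)
  refine ⟨ν.map T.coding, Measure.isProbabilityMeasure_map hmeas.aemeasurable, fun f hf => ?_⟩
  have htau : ∀ b, Continuous (T.tau b) := fun b =>
    ((Matrix.mulVecLin (realMat T.R)⁻¹).continuous_of_finiteDimensional).comp
      (continuous_id.add continuous_const)
  have h1 : ∀ b, ∫ t, f (T.tau b t) ∂(ν.map T.coding) = ∫ ω, f (T.coding (T.consWord b ω)) ∂ν := by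
    intro b
    have hfb : Continuous fun t => f (T.tau b t) := hf.comp (htau b)
    rw [integral_map hmeas.aemeasurable hfb.aestronglyMeasurable]
    simp_rw [coding_consWord]
  simp_rw [h1]
  have hg : Continuous fun ω => f (T.coding ω) := hf.comp T.continuous_coding
  rw [integral_map hmeas.aemeasurable hf.aestronglyMeasurable]
  conv_lhs => rw [show ν = _ from T.map_consWord.symm]
  have hcomp : Integrable (fun p : T.B × (ℕ → T.B) => f (T.coding (T.consWord p.1 p.2)))
      (T.unif.prod ν) := by
    have := hint _ hg
    rw [show ν = _ from T.map_consWord.symm] at this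
    exact (integrable_map_measure hg.aestronglyMeasurable
      T.measurable_consWord.aemeasurable).mp this
  rw [integral_map T.measurable_consWord.aemeasurable hg.aestronglyMeasurable,
    integral_prod _ hcomp, integral_fintype (Integrable.of_finite), Finset.mul_sum]
  refine Finset.sum_congr rfl fun b _ => ?_
  rw [measureReal_def, unif_singleton]
  simp [ν]

lemma IsInvariantMeasure.unique {μ μ' : Measure (Fin d → ℝ)}
    (h : T.IsInvariantMeasure μ) (h' : T.IsInvariantMeasure μ') : μ = μ' := by
  have := h.1
  have := h'.1
  have hN : (0 : ℝ) < T.N := by exact_mod_cast T.N_pos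
  have hcont : ∀ x : Fin d → ℝ, Continuous fun t : Fin d → ℝ => expi (t ⬝ᵥ x) := fun x => by
    unfold dotProduct; fun_prop
  have hstep : ∀ (ρ : Measure (Fin d → ℝ)), T.IsInvariantMeasure ρ → ∀ x,
      ∫ t, expi (t ⬝ᵥ x) ∂ρ = ((1 / (T.N : ℂ)) * ∑ b : T.B, expi (vec b.1 ⬝ᵥ T.S⁻¹ *ᵥ x)) *
        ∫ t, expi (t ⬝ᵥ T.S⁻¹ *ᵥ x) ∂ρ := by
    intro ρ hρ x
    rw [hρ.2 _ (hcont x), mul_assoc, Finset.sum_mul]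
    congr 1
    refine Finset.sum_congr rfl fun b _ => ?_
    rw [← integral_const_mul]
    refine integral_congr_ae (Eventually.of_forall fun t => ?_)
    simp only [tau]
    rw [← expi_add, ← add_dotProduct, dot_inv_S, add_comm t]
  let D : (Fin d → ℝ) → ℂ := fun x => ∫ t, expi (t ⬝ᵥ x) ∂μ - ∫ t, expi (t ⬝ᵥ x) ∂μ'
  have hDc : Continuous D := by
    have : ∀ (ρ : Measure (Fin d → ℝ)) [IsProbabilityMeasure ρ],
        Continuous fun x => ∫ t, expi (t ⬝ᵥ x) ∂ρ := by
      intro ρ _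
      refine continuous_of_dominated (bound := fun _ => 1)
        (fun x => (hcont x).aestronglyMeasurable)
        (fun x => Eventually.of_forall fun t => (norm_expi _).le) (integrable_const _)
        (Eventually.of_forall fun t => ?_)
      unfold dotProduct; fun_prop
    exact (this μ).sub (this μ')
  have hD0 : D 0 = 0 := by simp [D]
  have hDle : ∀ x, ‖D x‖ ≤ ‖D (T.S⁻¹ *ᵥ x)‖ := by
    intro x
    have : D x = ((1 / (T.N : ℂ)) * ∑ b : T.B, expi (vec b.1 ⬝ᵥ T.S⁻¹ *ᵥ x)) *
        D (T.S⁻¹ *ᵥ x) := by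
      simp only [D]; rw [hstep μ h, hstep μ' h', mul_sub]
    rw [this, norm_mul]
    refine mul_le_of_le_one_left (norm_nonneg _) ?_
    rw [norm_mul, norm_div, norm_one, Complex.norm_natCast, one_div, inv_mul_le_one₀ hN]
    refine (norm_sum_le _ _).trans ?_
    simp [norm_expi, N]
  have hDpow : ∀ x (k : ℕ), ‖D x‖ ≤ ‖D ((T.S⁻¹ ^ k) *ᵥ x)‖ := by
    intro x k
    induction k with
    | zero => simp
    | succ k ih =>
      refine (ih.trans (hDle _)).trans (le_of_eq ?_)
      rw [Matrix.mulVec_mulVec, ← pow_succ']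
  have hDz : ∀ x, D x = 0 := by
    intro x
    have ht : Tendsto (fun k : ℕ => ‖D ((T.S⁻¹ ^ k) *ᵥ x)‖) atTop (𝓝 ‖D 0‖) :=
      ((hDc.tendsto 0).comp (T.tendsto_inv_S_pow x)).norm
    have := ge_of_tendsto' ht (hDpow x)
    rw [hD0, norm_zero] at this
    exact norm_le_zero_iff.mp this
  refine Measure.ext_of_charFunDual (funext fun ℓ => ?_)
  rw [charFunDual_apply, charFunDual_apply]
  have hℓ : ∀ t : Fin d → ℝ, Complex.exp (ℓ t * Complex.I) =
      expi (t ⬝ᵥ fun i => ℓ (Pi.single i 1) / (2 * Real.pi)) := by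
    intro t
    have h1 : ℓ t = ∑ i, t i * ℓ (Pi.single i 1) := by
      conv_lhs => rw [pi_eq_sum_univ' t, map_sum]
      simp
    have h2 : t ⬝ᵥ (fun i => ℓ (Pi.single i 1) / (2 * Real.pi)) = ℓ t / (2 * Real.pi) := by
      rw [h1, dotProduct, Finset.sum_div]
      exact Finset.sum_congr rfl fun i _ => by ring
    have hpi : (Real.pi : ℂ) ≠ 0 := by exact_mod_cast Real.pi_ne_zero
    rw [h2, expi]
    congr 1
    push_cast
    field_simp
  simp_rw [hℓ]
  exact sub_eq_zero.mp (hDz _)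

theorem existsUnique_isInvariantMeasure : ∃! μ, T.IsInvariantMeasure μ :=
  ⟨_, T.exists_isInvariantMeasure.choose_spec, fun _ h =>
    IsInvariantMeasure.unique T h T.exists_isInvariantMeasure.choose_spec⟩

theorem existsUnique_isPathMeasure (x : Fin d → ℝ) : ∃! P, T.IsPathMeasure x P :=
  ⟨_, (T.exists_isPathMeasure x).choose_spec, fun _ h =>
    IsPathMeasure.unique T h (T.exists_isPathMeasure x).choose_spec⟩

/-- The invariant measure `μ` of the system `(τ_b)`, the unique one with the defining property. -/
def invariantMeasure : Measure (Fin d → ℝ) := T.existsUnique_isInvariantMeasure.choose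

theorem isInvariantMeasure_invariantMeasure : T.IsInvariantMeasure T.invariantMeasure :=
  T.existsUnique_isInvariantMeasure.choose_spec.1

/-- The path measure `P_x` on the infinite words, the unique one with the defining property. -/
def pathMeasure (x : Fin d → ℝ) : Measure T.Words := (T.existsUnique_isPathMeasure x).choose

theorem isPathMeasure_pathMeasure (x : Fin d → ℝ) : T.IsPathMeasure x (T.pathMeasure x) :=
  (T.existsUnique_isPathMeasure x).choose_spec.1

/-! ### Spectra of invariant sets -/

/-- The Fourier transform of the invariant measure, `∫ e^{2 π i t · x} dμ(t)`. -/
def muHat (x : Fin d → ℝ) : ℂ := ∫ t, expi (t ⬝ᵥ x) ∂T.invariantMeasure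

/-- The set `N(F)` of the words `ω` with `d(σ_{ω_n} ⋯ σ_{ω_1} x, F) → 0`. The base point `x` does
not matter, see `mem_attractedWords_iff`; it is taken to be `0`. -/
def attractedWords (F : Set (Fin d → ℝ)) : Set T.Words :=
  {ω | Tendsto (fun n => Metric.infEDist (T.walk ω n 0) F) atTop (𝓝 0)}

theorem mem_attractedWords_iff (F : Set (Fin d → ℝ)) (ω : T.Words) (x : Fin d → ℝ) :
    ω ∈ T.attractedWords F ↔
      Tendsto (fun n => Metric.infEDist (T.walk ω n x) F) atTop (𝓝 0) := by
  have hsub : ∀ (y z : Fin d → ℝ) (n : ℕ),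
      T.walk ω n y - T.walk ω n z = (T.S⁻¹ ^ n) *ᵥ (y - z) := by
    intro y z n
    induction n with
    | zero => simp [walk]
    | succ n ih =>
      rw [walk, walk, sigma, sigma, ← Matrix.mulVec_sub, add_sub_add_right_eq_sub, ih,
        Matrix.mulVec_mulVec, ← pow_succ']
  have hmain : ∀ y z : Fin d → ℝ,
      Tendsto (fun n => Metric.infEDist (T.walk ω n y) F) atTop (𝓝 0) →
      Tendsto (fun n => Metric.infEDist (T.walk ω n z) F) atTop (𝓝 0) := by
    intro y z h
    have hd : Tendsto (fun n => edist (T.walk ω n z) (T.walk ω n y)) atTop (𝓝 0) := by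
      have h1 := (T.tendsto_inv_S_pow (z - y)).enorm
      rw [enorm_zero] at h1
      refine h1.congr fun n => ?_
      rw [edist_eq_enorm_sub, hsub]
    have h2 := h.add hd
    rw [add_zero] at h2
    exact tendsto_of_tendsto_of_tendsto_of_le_of_le tendsto_const_nhds h2 (fun _ => zero_le)
      fun n => Metric.infEDist_le_infEDist_add_edist
  exact ⟨hmain 0 x, hmain x 0⟩

/-- `Λ` is a spectrum for the closed invariant set `F`:
`P_x(N(F)) = ∑_{λ ∈ Λ} |μ̂(x + λ)|²` for every `x ∈ ℝ^d`. -/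
def IsSpectrumOf (F Λ : Set (Fin d → ℝ)) : Prop :=
  ∀ x : Fin d → ℝ,
    HasSum (fun v : Λ => ‖T.muHat (x + v.1)‖ ^ 2) ((T.pathMeasure x).real (T.attractedWords F))

/-- `F` is a spectral invariant set. -/
def IsSpectralInvariant (F : Set (Fin d → ℝ)) : Prop :=
  T.IsClosedInvariant F ∧ ∃ Λ, T.IsSpectrumOf F Λ

/-- `S Λ + L ⊆ Λ`. -/
def IsStable (Λ : Set (Fin d → ℝ)) : Prop :=
  ∀ v ∈ Λ, ∀ l ∈ T.L, T.S *ᵥ v + vec l ∈ Λ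

end HadamardTriple
end FourierIFS

end

namespace FourierIFS

variable {d : ℕ}

/-! The spectrum of the cycle $C$ is the set of points $v$ such that the walk of $-v$ along some
word $\omega$ eventually stays in $C$. The proof matches these points with the words of $N(C)$ and
computes the mass of each such word.

At a point of $C$ the equality $W_B=1$ is equality in the triangle inequality, and since $0\in B$
every character $e^{2\pi i b\cdot x}$ equals 1 there. Going around the cycle and using that $S$
preserves $\mathbb{Z}^d$, the same holds at $S^k x$ for all $k\ge 0$
(`IsWCycle.subset_trivialPoints`). This stronger property passes backwards along walks, so if the
walk of $-v$ along $\omega$ ends in $C$, all its points $y_n$ are periods of $W_B$. As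
$\sigma_{\omega_n}\cdots\sigma_{\omega_1}x=y_n+S^{-n}(x+v)$, the mass of $\omega$ is
$P_x(\{\omega\})=\prod_n W_B(S^{-n}(x+v))=|\hat\mu(x+v)|^2$ (`EntersAlong.pathMeasure_singleton`).

Each $v$ determines $\omega$, because a letter leading to $W_B=1$ excludes all others; each
$\omega\in N(C)$ determines $v$, because a sequence in a finite set that tends to a point is
eventually equal to it. The set of these $v$ is countable, so the masses add up to $P_x(N(C))$. It
is the least stable set containing $-C$ because $w=Sv+l$ means exactly $\sigma_l(-w)=-v$
(`IsCycle.isLeast_cycleSpectrum`). -/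

/-! ### Characters at integers, integer vectors, and two general facts. -/

lemma expi_zero : expi 0 = 1 := by simp [expi]

lemma expi_intCast (n : ℤ) : expi n = 1 := by
  rw [expi, Complex.exp_eq_one_iff]
  exact ⟨n, by push_cast; ring⟩

lemma vec_dotProduct_vec (a b : Fin d → ℤ) : vec a ⬝ᵥ vec b = ((a ⬝ᵥ b : ℤ) : ℝ) := by
  simp [vec, dotProduct]

lemma vec_zero : vec (0 : Fin d → ℤ) = 0 := by ext; simp [vec]

lemma vec_add (a b : Fin d → ℤ) : vec (a + b) = vec a + vec b := by ext; simp [vec]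

/-- A sequence in a finite set which tends to a point is eventually equal to that point. -/
lemma eventually_eq_of_tendsto_of_finite {X : Type*} [TopologicalSpace X] [T1Space X]
    {s : Set X} (hs : s.Finite) {u : ℕ → X} {a : X} (hu : ∀ n, u n ∈ s)
    (ht : Tendsto u atTop (𝓝 a)) : ∀ᶠ n in atTop, u n = a := by
  have h : (s \ {a})ᶜ ∈ 𝓝 a := (hs.subset Set.sdiff_subset).isClosed.isOpen_compl.mem_nhds (by simp)
  filter_upwards [ht h] with n hn
  by_contra hne
  exact hn ⟨hu n, hne⟩

/-- Unit complex numbers whose mean has modulus one coincide with their mean. -/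
lemma eq_mean_of_norm_mean_eq_one {ι : Type*} [Fintype ι] [Nonempty ι] {z : ι → ℂ}
    (hz : ∀ i, ‖z i‖ = 1) {u : ℂ} (hu : ∑ i, z i = Fintype.card ι * u) (hu1 : ‖u‖ = 1) (i : ι) :
    z i = u := by
  have huu : u * starRingEnd ℂ u = 1 := by
    rw [Complex.mul_conj, Complex.normSq_eq_norm_sq, hu1]; simp
  -- Each real part is at most 1 and together they sum to the number of terms, so none of the
  -- inequalities is strict.
  have hle : ∀ i ∈ Finset.univ, (z i * starRingEnd ℂ u).re ≤ 1 := fun i _ =>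
    (Complex.re_le_norm _).trans (by rw [norm_mul, hz, RCLike.norm_conj, hu1, one_mul])
  have hsum : ∑ i, (z i * starRingEnd ℂ u).re = ∑ _i : ι, (1 : ℝ) := by
    rw [← Complex.re_sum, ← Finset.sum_mul, hu, mul_assoc, huu]
    simp
  have hre := (Finset.sum_eq_sum_iff_of_le hle).mp hsum i (Finset.mem_univ i)
  have hone : z i * starRingEnd ℂ u = 1 := by
    have hn : ‖z i * starRingEnd ℂ u‖ = 1 := by rw [norm_mul, hz, RCLike.norm_conj, hu1, one_mul]
    have hsq := Complex.sq_norm (z i * starRingEnd ℂ u)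
    rw [Complex.normSq_apply, hn, hre] at hsq
    refine Complex.ext hre ?_
    rw [Complex.one_im]
    nlinarith
  calc z i = z i * (u * starRingEnd ℂ u) := by rw [huu, mul_one]
    _ = z i * starRingEnd ℂ u * u := by ring
    _ = u := by rw [hone, one_mul]

namespace HadamardTriple

variable (T : HadamardTriple d)

/-! ### The maps `σ_l` -/

lemma isUnit_det_S : IsUnit T.S.det := by
  rw [S, Matrix.det_transpose]
  exact isUnit_iff_ne_zero.mpr T.det_ne_zero

lemma S_mulVec_sigma (l : T.L) (x : Fin d → ℝ) : T.S *ᵥ T.sigma l x = x + vec l.1 := by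
  rw [sigma, Matrix.mulVec_mulVec, Matrix.mul_nonsing_inv _ T.isUnit_det_S, Matrix.one_mulVec]

lemma sigma_S_mulVec_sub (l : T.L) (x : Fin d → ℝ) : T.sigma l (T.S *ᵥ x - vec l.1) = x := by
  rw [sigma, sub_add_cancel, Matrix.mulVec_mulVec, Matrix.nonsing_inv_mul _ T.isUnit_det_S,
    Matrix.one_mulVec]

lemma sigma_sub_sigma (l : T.L) (x y : Fin d → ℝ) :
    T.sigma l x - T.sigma l y = T.S⁻¹ *ᵥ (x - y) := by
  rw [sigma, sigma, ← Matrix.mulVec_sub, add_sub_add_right_eq_sub]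

lemma S_mulVec_vec (v : Fin d → ℤ) : T.S *ᵥ vec v = vec (T.Rᵀ *ᵥ v) := by
  ext i
  simp [S, realMat, vec, Matrix.mulVec, dotProduct]

lemma exists_S_pow_mulVec_vec (k : ℕ) (v : Fin d → ℤ) :
    ∃ w : Fin d → ℤ, (T.S ^ k) *ᵥ vec v = vec w := by
  induction k with
  | zero => exact ⟨v, by simp⟩
  | succ k ih =>
    obtain ⟨w, hw⟩ := ih
    exact ⟨T.Rᵀ *ᵥ w, by rw [pow_succ', ← Matrix.mulVec_mulVec, hw, S_mulVec_vec]⟩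

/-! ### Walks -/

/-- The word `l ω₀ ω₁ …`. -/
def consLetter (l : T.L) (ω : T.Words) : T.Words := fun n => Nat.casesOn n l ω

lemma walk_consLetter (l : T.L) (ω : T.Words) (n : ℕ) (x : Fin d → ℝ) :
    T.walk (T.consLetter l ω) (n + 1) x = T.walk ω n (T.sigma l x) := by
  induction n with
  | zero => rfl
  | succ n ih => rw [walk, ih]; rfl

lemma walk_succ_eq_walk_tail (ω : T.Words) (n : ℕ) (x : Fin d → ℝ) :
    T.walk ω (n + 1) x = T.walk (fun k => ω (k + 1)) n (T.sigma (ω 0) x) := by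
  induction n with
  | zero => rfl
  | succ n ih => rw [walk, ih]; rfl

/-- All the maps $\sigma_l$ have the same linear part $S^{-1}$, so the letters cancel in
differences. -/
lemma walk_sub_walk (ω : T.Words) (n : ℕ) (x y : Fin d → ℝ) :
    T.walk ω n x - T.walk ω n y = (T.S⁻¹ ^ n) *ᵥ (x - y) := by
  induction n with
  | zero => simp [walk]
  | succ n ih => rw [walk, walk, sigma_sub_sigma, ih, Matrix.mulVec_mulVec, ← pow_succ']

lemma S_pow_mulVec_inv_pow_mulVec (n : ℕ) (x : Fin d → ℝ) :
    (T.S ^ n) *ᵥ ((T.S⁻¹ ^ n) *ᵥ x) = x := by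
  rw [Matrix.mulVec_mulVec, Matrix.inv_pow',
    Matrix.mul_nonsing_inv _ (by rw [Matrix.det_pow]; exact T.isUnit_det_S.pow n),
    Matrix.one_mulVec]

lemma walk_surjective (ω : T.Words) (n : ℕ) : Function.Surjective (T.walk ω n) := by
  induction n with
  | zero => exact fun y => ⟨y, rfl⟩
  | succ n ih =>
    intro y
    obtain ⟨x, hx⟩ := ih (T.S *ᵥ y - vec (ω n).1)
    exact ⟨x, by rw [walk, hx, sigma_S_mulVec_sub]⟩

/-! ### Points at which all characters are trivial -/

/-- The points `y` such that `b · S^k y ∈ ℤ` for all `b ∈ B` and `k ≥ 0`. -/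
def trivialPoints : Set (Fin d → ℝ) :=
  {y | ∀ b : T.B, ∀ k : ℕ, expi (vec b.1 ⬝ᵥ ((T.S ^ k) *ᵥ y)) = 1}

variable {T}

/-- $S$ is an integer matrix, so $S^k v$ pairs with $b$ to an integer. -/
lemma expi_dotProduct_S_pow_add_vec (b : T.B) (k : ℕ) (y : Fin d → ℝ) (v : Fin d → ℤ) :
    expi (vec b.1 ⬝ᵥ ((T.S ^ k) *ᵥ (y + vec v))) = expi (vec b.1 ⬝ᵥ ((T.S ^ k) *ᵥ y)) := by
  obtain ⟨w, hw⟩ := T.exists_S_pow_mulVec_vec k v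
  rw [Matrix.mulVec_add, dotProduct_add, expi_add, hw, vec_dotProduct_vec, expi_intCast, mul_one]

/-- Since $S\sigma_l y=y+l$, the condition on $y$ with exponent $k$ is, up to an integer vector, the
condition on $\sigma_l y$ with exponent $k+1$. Asking for all powers of $S$ is what makes triviality
pass backwards. -/
lemma mem_trivialPoints_of_sigma_mem {l : T.L} {y : Fin d → ℝ}
    (h : T.sigma l y ∈ T.trivialPoints) : y ∈ T.trivialPoints := by
  intro b k
  have := h b (k + 1)
  rwa [pow_succ, ← Matrix.mulVec_mulVec, S_mulVec_sigma, expi_dotProduct_S_pow_add_vec] at this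

lemma mem_trivialPoints_of_walk_mem {ω : T.Words} {y : Fin d → ℝ} {m n : ℕ} (hmn : m ≤ n)
    (h : T.walk ω n y ∈ T.trivialPoints) : T.walk ω m y ∈ T.trivialPoints := by
  induction n, hmn using Nat.le_induction with
  | base => exact h
  | succ n _ ih => exact ih (mem_trivialPoints_of_sigma_mem h)

lemma W_add_of_mem_trivialPoints {y : Fin d → ℝ} (hy : y ∈ T.trivialPoints) (z : Fin d → ℝ) :
    T.W (y + z) = T.W z := by
  have h : ∀ b : T.B, expi (vec b.1 ⬝ᵥ y) = 1 := fun b => by simpa using hy b 0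
  simp only [W, dotProduct_add, expi_add, h, one_mul]

lemma W_zero : T.W 0 = 1 := by
  have hN : (T.N : ℂ) ≠ 0 := by exact_mod_cast T.N_pos.ne'
  have hc : (T.B.card : ℂ) = T.N := rfl
  simp [W, expi_zero, hc, hN]

lemma W_eq_one_of_mem_trivialPoints {y : Fin d → ℝ} (hy : y ∈ T.trivialPoints) : T.W y = 1 := by
  have := W_add_of_mem_trivialPoints hy 0
  rwa [add_zero, W_zero] at this

/-- Equality in the triangle inequality makes all the characters equal to one another. -/
lemma expi_dotProduct_eq_one_of_W_eq_one {y : Fin d → ℝ} (hy : T.W y = 1) (b : T.B) :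
    expi (vec b.1 ⬝ᵥ y) = 1 := by
  have hN : (T.N : ℂ) ≠ 0 := by exact_mod_cast T.N_pos.ne'
  have hcard : (Fintype.card T.B : ℂ) = T.N := by simp [N]
  have key := eq_mean_of_norm_mean_eq_one (z := fun b : T.B => expi (vec b.1 ⬝ᵥ y))
    (fun _ => norm_expi _) (u := (1 / (T.N : ℂ)) * ∑ b : T.B, expi (vec b.1 ⬝ᵥ y))
    (by rw [hcard]; field_simp) ((pow_eq_one_iff_of_nonneg (norm_nonneg _) two_ne_zero).mp hy)
  -- The term $b=0$ identifies the common value as 1.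
  have h0 := key ⟨0, T.zero_mem_B⟩
  simp only [vec_zero, zero_dotProduct, expi_zero] at h0
  exact (key b).trans h0.symm

/-- The numbers $W_B(\sigma_l y)$ are nonnegative and sum to 1 over $l$, so one of them being 1
forces the others to vanish. -/
lemma letter_eq_of_W_eq_one_of_W_ne_zero {y : Fin d → ℝ} {l l' : T.L}
    (h : T.W (T.sigma l y) = 1) (h' : T.W (T.sigma l' y) ≠ 0) : l' = l := by
  classical
  by_contra hne
  have h2 := Finset.sum_le_sum_of_subset_of_nonneg (Finset.subset_univ {l', l})
    fun i _ _ => T.W_nonneg (T.sigma i y)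
  rw [T.sum_W, Finset.sum_pair hne, h] at h2
  exact h' (le_antisymm (by linarith) (T.W_nonneg _))

/-! ### Cycles -/

section Cycle

variable {C : Set (Fin d → ℝ)}

lemma IsCycle.finite (hC : T.IsCycle C) : C.Finite := by
  obtain ⟨m, l, x₀, -, -, -, rfl⟩ := hC
  exact (Set.finite_Iio m).image _

lemma IsCycle.exists_sigma_mem (hC : T.IsCycle C) {y : Fin d → ℝ} (hy : y ∈ C) :
    ∃ l, T.sigma l y ∈ C := by
  obtain ⟨m, l, x₀, hm, -, hx, rfl⟩ := hC
  obtain ⟨k, hk, rfl⟩ := hy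
  refine ⟨l k, ?_⟩
  rcases (Nat.succ_le_of_lt hk).lt_or_eq with h | h
  · exact ⟨k + 1, h, rfl⟩
  -- The last point of the cycle is sent back to $x_0$.
  · refine ⟨0, hm, ?_⟩
    change x₀ = T.walk l k.succ x₀
    rw [h, hx]

lemma IsCycle.exists_sigma_eq (hC : T.IsCycle C) {y : Fin d → ℝ} (hy : y ∈ C) :
    ∃ z ∈ C, ∃ l, T.sigma l z = y := by
  obtain ⟨m, l, x₀, hm, -, hx, rfl⟩ := hC
  obtain ⟨k, hk, rfl⟩ := hy
  cases k with
  | zero =>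
    obtain ⟨m, rfl⟩ := Nat.exists_eq_succ_of_ne_zero (Nat.one_le_iff_ne_zero.mp hm)
    exact ⟨_, ⟨m, Nat.lt_succ_self m, rfl⟩, l m, hx⟩
  | succ k => exact ⟨_, ⟨k, (Nat.lt_succ_self k).trans hk, rfl⟩, l k, rfl⟩

/-- Every point of $C$ has a predecessor $z\in C$, and $S^{k+1}\sigma_l z=S^k(z+l)$. Induction on
the exponent thus moves backwards around the cycle, down to exponent 0, where $W_B=1$ applies. -/
lemma IsWCycle.subset_trivialPoints (hC : T.IsWCycle C) : C ⊆ T.trivialPoints := by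
  intro y hy b k
  induction k generalizing y with
  | zero => simpa using expi_dotProduct_eq_one_of_W_eq_one (hC.2 y hy) b
  | succ k ih =>
    obtain ⟨z, hz, l, rfl⟩ := hC.1.exists_sigma_eq hy
    rw [pow_succ, ← Matrix.mulVec_mulVec, S_mulVec_sigma, expi_dotProduct_S_pow_add_vec]
    exact ih hz

lemma IsWCycle.sigma_mem_of_W_ne_zero (hC : T.IsWCycle C) {y : Fin d → ℝ} (hy : y ∈ C) {l : T.L}
    (h : T.W (T.sigma l y) ≠ 0) : T.sigma l y ∈ C := by
  obtain ⟨l', hl'⟩ := hC.1.exists_sigma_mem hy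
  rwa [letter_eq_of_W_eq_one_of_W_ne_zero (hC.2 _ hl') h]

theorem IsWCycle.isClosedInvariant (hC : T.IsWCycle C) : T.IsClosedInvariant C := by
  refine ⟨hC.1.finite.isClosed, fun x hx => closure_minimal ?_ hC.1.finite.isClosed⟩
  rintro _ ⟨ω, hω, n, -, rfl⟩
  induction n with
  | zero => exact hx
  | succ n ih => exact hC.sigma_mem_of_W_ne_zero ih (hω (n + 1) (Nat.succ_pos n))

/-! ### The correspondence between attracted words and starting points. -/

variable (T C) in
/-- The walk of `-v` along `ω` eventually stays in `C`. -/
def EntersAlong (ω : T.Words) (v : Fin d → ℝ) : Prop :=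
  ∀ᶠ n in atTop, T.walk ω n (-v) ∈ C

variable (T C) in
/-- The points `v` such that some walk of `-v` eventually stays in `C`. -/
def cycleSpectrum : Set (Fin d → ℝ) := {v | ∃ ω, T.EntersAlong C ω v}

lemma EntersAlong.walk_mem_trivialPoints (hC : T.IsWCycle C) {ω : T.Words} {v : Fin d → ℝ}
    (h : T.EntersAlong C ω v) (n : ℕ) : T.walk ω n (-v) ∈ T.trivialPoints := by
  obtain ⟨m, hm⟩ := eventually_atTop.mp h
  exact mem_trivialPoints_of_walk_mem (le_max_left n m)
    (hC.subset_trivialPoints (hm _ (le_max_right n m)))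

/-- After a common prefix both walks are at the same point and both next letters lead to $W_B=1$, so
these letters agree. -/
lemma EntersAlong.word_unique (hC : T.IsWCycle C) {ω η : T.Words} {v : Fin d → ℝ}
    (h : T.EntersAlong C ω v) (h' : T.EntersAlong C η v) : ω = η := by
  funext n
  induction n using Nat.strong_induction_on with
  | _ n ih =>
    have h1 := W_eq_one_of_mem_trivialPoints (h.walk_mem_trivialPoints hC (n + 1))
    have h2 := W_eq_one_of_mem_trivialPoints (h'.walk_mem_trivialPoints hC (n + 1))
    rw [walk] at h1 h2
    rw [← T.walk_congr ih] at h2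
    exact letter_eq_of_W_eq_one_of_W_ne_zero h2 (by rw [h1]; exact one_ne_zero)

/-- The difference of the two walks tends to 0 and eventually lies in the finite set $C-C$, so it
vanishes at some time. Invertibility of $S^{-1}$ brings this back to the starting points. -/
lemma EntersAlong.point_unique (hC : C.Finite) {ω : T.Words} {v w : Fin d → ℝ}
    (h : T.EntersAlong C ω v) (h' : T.EntersAlong C ω w) : v = w := by
  obtain ⟨m, hm⟩ := eventually_atTop.mp (h.and h')
  have ht : Tendsto (fun n => T.walk ω (n + m) (-v) - T.walk ω (n + m) (-w)) atTop (𝓝 0) := by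
    simp_rw [walk_sub_walk]
    exact (tendsto_add_atTop_iff_nat m).mpr (T.tendsto_inv_S_pow (-v - -w))
  have hfin : (Set.image2 (fun a b => a - b) C C).Finite := hC.image2 _ hC
  obtain ⟨n, hn⟩ := (eventually_eq_of_tendsto_of_finite hfin (fun n =>
    ⟨_, (hm _ (Nat.le_add_left m n)).1, _, (hm _ (Nat.le_add_left m n)).2, rfl⟩) ht).exists
  simp only [walk_sub_walk] at hn
  have h1 := T.S_pow_mulVec_inv_pow_mulVec (n + m) (-v - -w)
  rw [hn, Matrix.mulVec_zero] at h1
  exact (neg_injective (sub_eq_zero.mp h1.symm))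

lemma EntersAlong.mem_attractedWords {ω : T.Words} {v : Fin d → ℝ}
    (h : T.EntersAlong C ω v) : ω ∈ T.attractedWords C := by
  rw [T.mem_attractedWords_iff C ω (-v)]
  refine tendsto_const_nhds.congr' ?_
  filter_upwards [h] with n hn
  exact (Metric.infEDist_zero_of_mem hn).symm

/-- Let $y_n\in C$ be nearest to the $n$-th point of the walk of 0. The errors
$\sigma_{\omega_n}y_n-y_{n+1}$ tend to 0 and take finitely many values, so from some time $m$ on
$(y_n)$ is an exact walk along $\omega$. Inverting the first $m$ maps at $y_m$ gives the starting
point. -/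
lemma exists_entersAlong_of_mem_attractedWords (hC : C.Finite) (hne : C.Nonempty) {ω : T.Words}
    (h : ω ∈ T.attractedWords C) : ∃ v, T.EntersAlong C ω v := by
  choose y hyC hy using fun n => hC.isCompact.exists_infEDist_eq_edist hne (T.walk ω n 0)
  have hu : Tendsto (fun n => T.walk ω n 0 - y n) atTop (𝓝 0) := by
    have h1 : Tendsto (fun n => Metric.infEDist (T.walk ω n 0) C) atTop (𝓝 0) := h
    simp_rw [hy] at h1
    rw [tendsto_iff_edist_tendsto_0]
    simpa [edist_eq_enorm_sub] using h1
  have hcont : Continuous fun v : Fin d → ℝ => T.S⁻¹ *ᵥ v :=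
    (Matrix.mulVecLin T.S⁻¹).continuous_of_finiteDimensional
  have ht : Tendsto (fun n => T.sigma (ω n) (y n) - y (n + 1)) atTop (𝓝 0) := by
    -- With $u_n$ the $n$-th walk point minus $y_n$, the error is $u_{n+1}-S^{-1}u_n$.
    have h1 := ((tendsto_add_atTop_iff_nat 1).mpr hu).sub ((hcont.tendsto 0).comp hu)
    rw [Matrix.mulVec_zero, sub_zero] at h1
    refine h1.congr fun n => ?_
    simp only [Function.comp_apply]
    rw [← T.sigma_sub_sigma (ω n), walk]
    abel
  have hfin : (Set.image2 (fun a b => a - b) (Set.image2 T.sigma Set.univ C) C).Finite :=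
    (Set.finite_univ.image2 _ hC).image2 _ hC
  obtain ⟨m, hm⟩ := eventually_atTop.mp (eventually_eq_of_tendsto_of_finite hfin
    (fun n => ⟨_, ⟨ω n, Set.mem_univ _, y n, hyC n, rfl⟩, _, hyC (n + 1), rfl⟩) ht)
  obtain ⟨x, hx⟩ := T.walk_surjective ω m (y m)
  refine ⟨-x, eventually_atTop.mpr ⟨m, fun n hn => ?_⟩⟩
  have : T.walk ω n x = y n := by
    induction n, hn using Nat.le_induction with
    | base => exact hx
    | succ n hn ih => rw [walk, ih, sub_eq_zero.mp (hm n hn)]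
  rw [neg_neg, this]
  exact hyC n

/-! ### The spectrum of a cycle as a least stable set -/

/-- Always choosing a letter that stays in $C$ gives a word along which $x$ never leaves the cycle.
-/
lemma exists_entersAlong_neg (hC : T.IsCycle C) {x : Fin d → ℝ} (hx : x ∈ C) :
    -x ∈ T.cycleSpectrum C := by
  choose! next hnext using fun y (hy : y ∈ C) => hC.exists_sigma_mem hy
  let y : ℕ → Fin d → ℝ := fun n => (fun z => T.sigma (next z) z)^[n] x
  have hy : ∀ n, y n ∈ C := by
    intro n
    induction n with
    | zero => exact hx
    | succ n ih =>
      simp only [y, Function.iterate_succ_apply']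
      exact hnext _ ih
  refine ⟨fun n => next (y n), Eventually.of_forall fun n => ?_⟩
  have : T.walk (fun n => next (y n)) n x = y n := by
    induction n with
    | zero => rfl
    | succ n ih => rw [walk, ih]; simp only [y, Function.iterate_succ_apply']
  rw [neg_neg, this]
  exact hy n

lemma isStable_cycleSpectrum : T.IsStable (T.cycleSpectrum C) := by
  rintro v ⟨ω, hω⟩ l hl
  refine ⟨T.consLetter ⟨l, hl⟩ ω, ?_⟩
  obtain ⟨m, hm⟩ := eventually_atTop.mp hω
  refine eventually_atTop.mpr ⟨m + 1, fun n hn => ?_⟩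
  obtain ⟨n, rfl⟩ := Nat.exists_eq_add_of_le' hn
  -- The letter $l$ sends $-(Sv+l)$ to $-v$, after which the walk continues along $\omega$.
  have h := T.sigma_S_mulVec_sub ⟨l, hl⟩ (-v)
  rw [neg_add, ← sub_eq_add_neg, ← Matrix.mulVec_neg, ← add_assoc, walk_consLetter, h]
  exact hm _ (Nat.le_add_left m n)

lemma mem_of_walk_mem {M : Set (Fin d → ℝ)} (hM : ∀ x ∈ C, -x ∈ M) (hS : T.IsStable M) (n : ℕ) :
    ∀ (ω : T.Words) (v : Fin d → ℝ), T.walk ω n (-v) ∈ C → v ∈ M := by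
  induction n with
  | zero => exact fun ω v h => by simpa [walk] using hM _ h
  | succ n ih =>
    intro ω v h
    rw [walk_succ_eq_walk_tail, ← neg_neg (T.sigma (ω 0) (-v))] at h
    -- For $w=-\sigma_{\omega_0}(-v)$ one has $Sw+\omega_0=v$, and $-w$ reaches $C$ one step sooner.
    have h1 := hS _ (ih _ _ h) _ (ω 0).2
    rwa [Matrix.mulVec_neg, S_mulVec_sigma, neg_add, neg_neg, neg_add_cancel_right] at h1

theorem IsCycle.isLeast_cycleSpectrum (hC : T.IsCycle C) :
    IsLeast {M : Set (Fin d → ℝ) | (∀ x ∈ C, -x ∈ M) ∧ T.IsStable M} (T.cycleSpectrum C) := by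
  refine ⟨⟨fun x hx => exists_entersAlong_neg hC hx, isStable_cycleSpectrum⟩, ?_⟩
  rintro M ⟨hM, hS⟩ v ⟨ω, hω⟩
  obtain ⟨n, hn⟩ := hω.exists
  exact mem_of_walk_mem hM hS n ω v hn

/-- The points $-S^n c+z$ with $c\in C$ and $z\in\mathbb{Z}^d$ form a countable stable set
containing $-C$, and leastness places the spectrum inside it. -/
lemma IsCycle.countable_cycleSpectrum (hC : T.IsCycle C) : (T.cycleSpectrum C).Countable := by
  have : Countable C := hC.finite.countable
  let g : ℕ × C × (Fin d → ℤ) → Fin d → ℝ := fun p => (T.S ^ p.1) *ᵥ (-p.2.1.1) + vec p.2.2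
  have hg : Set.range g ∈ {M : Set (Fin d → ℝ) | (∀ x ∈ C, -x ∈ M) ∧ T.IsStable M} := by
    refine ⟨fun x hx => ⟨(0, ⟨x, hx⟩, 0), by simp [g, vec_zero]⟩, ?_⟩
    rintro _ ⟨⟨n, c, v⟩, rfl⟩ l -
    refine ⟨(n + 1, c, T.Rᵀ *ᵥ v + l), ?_⟩
    simp only [g]
    rw [Matrix.mulVec_add, Matrix.mulVec_mulVec, ← pow_succ', S_mulVec_vec, vec_add, add_assoc]
  exact (Set.countable_range g).mono (hC.isLeast_cycleSpectrum.2 hg)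

end Cycle

/-! ### The Fourier transform of the invariant measure -/

lemma continuous_expi_dotProduct (x : Fin d → ℝ) :
    Continuous fun t : Fin d → ℝ => expi (t ⬝ᵥ x) := by
  unfold dotProduct; fun_prop

lemma continuous_muHat : Continuous T.muHat := by
  have := T.isInvariantMeasure_invariantMeasure.1
  refine continuous_of_dominated (bound := fun _ => 1)
    (fun x => (continuous_expi_dotProduct x).aestronglyMeasurable)
    (fun x => Eventually.of_forall fun t => (norm_expi _).le) (integrable_const _)
    (Eventually.of_forall fun t => ?_)
  unfold dotProduct; fun_prop

lemma muHat_zero : T.muHat 0 = 1 := by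
  have := T.isInvariantMeasure_invariantMeasure.1
  simp [muHat, expi_zero]

/-- This is the invariance of $\mu$ tested on a character, with $R^{-1}$ moved to the other factor
as $S^{-1}$. -/
lemma muHat_eq_mul (x : Fin d → ℝ) :
    T.muHat x = ((1 / (T.N : ℂ)) * ∑ b : T.B, expi (vec b.1 ⬝ᵥ T.S⁻¹ *ᵥ x)) *
      T.muHat (T.S⁻¹ *ᵥ x) := by
  rw [muHat, T.isInvariantMeasure_invariantMeasure.2 _ (continuous_expi_dotProduct x), mul_assoc,
    Finset.sum_mul]
  congr 1
  refine Finset.sum_congr rfl fun b _ => ?_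
  rw [muHat, ← integral_const_mul]
  refine integral_congr_ae (Eventually.of_forall fun t => ?_)
  simp only [tau]
  rw [← expi_add, ← add_dotProduct, dot_inv_S, add_comm t]

lemma norm_muHat_sq_eq_mul (x : Fin d → ℝ) :
    ‖T.muHat x‖ ^ 2 = T.W (T.S⁻¹ *ᵥ x) * ‖T.muHat (T.S⁻¹ *ᵥ x)‖ ^ 2 := by
  rw [muHat_eq_mul, norm_mul, mul_pow, W]

lemma norm_muHat_sq_eq_prod_mul (x : Fin d → ℝ) (n : ℕ) :
    ‖T.muHat x‖ ^ 2 = (∏ k ∈ Finset.range n, T.W ((T.S⁻¹ ^ (k + 1)) *ᵥ x)) *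
      ‖T.muHat ((T.S⁻¹ ^ n) *ᵥ x)‖ ^ 2 := by
  induction n with
  | zero => simp
  | succ n ih =>
    rw [ih, Finset.prod_range_succ, norm_muHat_sq_eq_mul, Matrix.mulVec_mulVec, ← pow_succ',
      mul_assoc]

/-- The remaining factor $|\hat\mu(S^{-n}x)|^2$ tends to $|\hat\mu(0)|^2=1$. -/
lemma tendsto_prod_W (x : Fin d → ℝ) :
    Tendsto (fun n => ∏ k ∈ Finset.range n, T.W ((T.S⁻¹ ^ (k + 1)) *ᵥ x)) atTop
      (𝓝 (‖T.muHat x‖ ^ 2)) := by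
  have h1 : Tendsto (fun n => ‖T.muHat ((T.S⁻¹ ^ n) *ᵥ x)‖ ^ 2) atTop (𝓝 1) := by
    have := (((continuous_muHat (T := T)).tendsto 0).comp (T.tendsto_inv_S_pow x)).norm.pow 2
    simpa [muHat_zero] using this
  have h2 := (tendsto_const_nhds (x := ‖T.muHat x‖ ^ 2)).div h1 one_ne_zero
  rw [div_one] at h2
  refine h2.congr' ?_
  -- The remaining factor may vanish for small $n$, so the division is made only for large $n$.
  filter_upwards [h1.eventually_ne one_ne_zero] with n hn
  rw [Pi.div_apply, norm_muHat_sq_eq_prod_mul x n, mul_div_cancel_right₀ _ hn]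

/-! ### Masses of words under the path measures -/

/-- The cylinders around $\omega$ decrease to $\{\omega\}$, and their masses are the partial
products. -/
lemma tendsto_prod_pathMeasure_singleton (x : Fin d → ℝ) (ω : T.Words) :
    Tendsto (fun n => ∏ k ∈ Finset.range n, T.W (T.walk ω (k + 1) x)) atTop
      (𝓝 ((T.pathMeasure x).real {ω})) := by
  have hP := T.isPathMeasure_pathMeasure x
  have := hP.1
  have hset : ({ω} : Set T.Words) = ⋂ n, {η | ∀ k < n, η k = ω k} := by
    ext η
    simp only [Set.mem_singleton_iff, Set.mem_iInter, Set.mem_ofPred_eq]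
    exact ⟨fun h n k _ => by rw [h], fun h => funext fun k => h (k + 1) k (Nat.lt_succ_self k)⟩
  have h := tendsto_measure_iInter_atTop (μ := T.pathMeasure x)
    (s := fun n => {η : T.Words | ∀ k < n, η k = ω k})
    (fun n => (T.measurableSet_cylinder n ω).nullMeasurableSet)
    (fun m n hmn η hη k hk => hη k (hk.trans_le hmn)) ⟨0, measure_ne_top _ _⟩
  rw [← hset] at h
  refine ((ENNReal.tendsto_toReal (measure_ne_top _ _)).comp h).congr fun n => ?_
  rw [Function.comp_apply, Function.comp_apply, hP.2 n ω,
    ENNReal.toReal_ofReal (Finset.prod_nonneg fun _ _ => T.W_nonneg _)]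

lemma EntersAlong.pathMeasure_singleton {C : Set (Fin d → ℝ)} (hC : T.IsWCycle C) {ω : T.Words}
    {v : Fin d → ℝ} (h : T.EntersAlong C ω v) (x : Fin d → ℝ) :
    (T.pathMeasure x).real {ω} = ‖T.muHat (x + v)‖ ^ 2 := by
  refine tendsto_nhds_unique (tendsto_prod_pathMeasure_singleton x ω)
    ((tendsto_prod_W (x + v)).congr fun n => Finset.prod_congr rfl fun k _ => ?_)
  have h1 := T.walk_sub_walk ω (k + 1) x (-v)
  rw [sub_neg_eq_add] at h1
  -- The walk of $x$ is the walk of $-v$ plus $S^{-(k+1)}(x+v)$, and the first summand is a period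
  -- of $W_B$.
  rw [← W_add_of_mem_trivialPoints (h.walk_mem_trivialPoints hC (k + 1)), ← h1, add_sub_cancel]

/-! ### Summation of the masses over the spectrum. -/

lemma hasSum_measureReal_singleton {ι Ω : Type*} [Countable ι] [MeasurableSpace Ω]
    [MeasurableSingletonClass Ω] (P : Measure Ω) [IsFiniteMeasure P] {f : ι → Ω}
    (hf : Function.Injective f) : HasSum (fun i => P.real {f i}) (P.real (Set.range f)) := by
  have h : P (Set.range f) = ∑' i, P {f i} := by
    rw [← Set.iUnion_singleton_eq_range, measure_iUnion
      (fun i j hij => by simpa using hf.ne hij) fun i => measurableSet_singleton _]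
  rw [measureReal_def, h, ENNReal.tsum_toReal_eq fun i => measure_ne_top _ _]
  exact (ENNReal.summable_toReal (h ▸ measure_ne_top P _)).hasSum

theorem IsWCycle.isSpectrumOf_cycleSpectrum {C : Set (Fin d → ℝ)} (hC : T.IsWCycle C) :
    T.IsSpectrumOf C (T.cycleSpectrum C) := by
  intro x
  have := (T.isPathMeasure_pathMeasure x).1
  have : Countable (T.cycleSpectrum C) := hC.1.countable_cycleSpectrum
  have hne : C.Nonempty := by
    obtain ⟨m, l, x₀, hm, -, -, rfl⟩ := hC.1
    exact ⟨_, 0, hm, rfl⟩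
  choose f hf using fun v : T.cycleSpectrum C => v.2
  have hinj : Function.Injective f := fun v w hvw =>
    Subtype.ext ((hf v).point_unique hC.1.finite (hvw ▸ hf w))
  have hrange : Set.range f = T.attractedWords C := by
    ext ω
    constructor
    · rintro ⟨v, rfl⟩
      exact (hf v).mem_attractedWords
    · intro hω
      obtain ⟨v, hv⟩ := exists_entersAlong_of_mem_attractedWords hC.1.finite hne hω
      -- The word chosen for $v$ is $\omega$ itself, by uniqueness of the word.
      exact ⟨⟨v, ω, hv⟩, (hf _).word_unique hC hv⟩
  rw [← hrange]
  refine (hasSum_measureReal_singleton (T.pathMeasure x) hinj).congr_fun fun v => ?_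
  exact ((hf v).pathMeasure_singleton hC x).symm

end HadamardTriple
end FourierIFS

theorem mainTheorem4 {d : ℕ} (T : FourierIFS.HadamardTriple d) (C : Set (Fin d → ℝ))
    (hC : T.IsWCycle C) :
    T.IsSpectralInvariant C ∧
      ∃ Λ : Set (Fin d → ℝ),
        IsLeast {M : Set (Fin d → ℝ) | (∀ x ∈ C, -x ∈ M) ∧ T.IsStable M} Λ ∧
          T.IsSpectrumOf C Λ :=
  ⟨⟨hC.isClosedInvariant, _, hC.isSpectrumOf_cycleSpectrum⟩,
    _, hC.1.isLeast_cycleSpectrum, hC.isSpectrumOf_cycleSpectrum⟩
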